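/- For $c\in\mathbb{R}$ let $(c)_n=c(c+1)\cdots(c+n-1)$, $(c)_0=1$, and for positive $a_1,a_2,b_1,b_2,b_3$ put $$\Phi(x)={}_2F_3\left[\begin{array}{c}a_1,a_2\\ b_1,b_2,b_3\end{array}\Big|\,-x^2\right]=\sum_{n=0}^\infty\frac{(a_1)_n(a_2)_n}{n!\,(b_1)_n(b_2)_n(b_3)_n}(-x^2)^n\qquad(x>0).$$ For $a_1,a_2>0$ let $\mathcal A\subset\mathbb{R}^3$ be the set of all permutations of $(a_2,\,a_1+\tfrac12,\,2a_1)$, let $\xi_1\le\xi_2\le\xi_3$ be the numbers $a_2,\,a_1+\tfrac12,\,2a_1$ arranged in ascending order, and let the Newton polyhedron $\Gamma_+(\mathcal A)$ be the convex hull of $\bigcup_{\mathbf x\in\mathcal A}(\mathbf x+[0,\infty)^3)$. Let $\Lambda$ be the set of $(a_1,a_2)$ with $a_1,a_2>0$ such that $$\begin{cases} a_2\le\frac12\left(3a_1+\frac12\right)\ \text{ or }\ 1\le a_2\le 2a_1+1 & \text{if } a_1\le\frac12,\\[2pt] a_2\le\max\left[a_1+\frac32,\ \frac32\left(a_1+\frac12\right)\right]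 & \text{if } a_1\ge\frac12.\end{cases}$$ **Theorem.** (i) If $(a_1,a_2)\in\Lambda$ and $(b_1,b_2,b_3)\in\Gamma_+(\mathcal A)$, then $\Phi(x)\ge 0$ for all $x>0$; moreover, if $(b_1,b_2,b_3)\notin\mathcal A$, then $\Phi(x)>0$ for all $x>0$. (ii) For all $a_1,a_2>0$, the set $\Gamma_+(\mathcal A)$ consists exactly of the points $(b_1,b_2,b_3)\in\mathbb{R}^3$ satisfying $$\min(b_1,b_2,b_3)\ge\xi_1,\qquad \min(b_1+b_2,\;b_2+b_3,\;b_1+b_3)\ge\xi_1+\xi_2,\qquad b_1+b_2+b_3\ge 3a_1+a_2+\tfrac12 .$$ -/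

import Mathlib

/-- The `n`-th term `(a₁)ₙ (a₂)ₙ / (n! (b₁)ₙ (b₂)ₙ (b₃)ₙ) · zⁿ` of the `₂F₃` series;
`(ascPochhammer ℝ n).eval c` is the Pochhammer symbol `(c)ₙ = c (c + 1) ⋯ (c + n - 1)`. -/
noncomputable def twoFThreeTerm (a₁ a₂ : ℝ) (b : Fin 3 → ℝ) (z : ℝ) (n : ℕ) : ℝ :=
  ((ascPochhammer ℝ n).eval a₁ * (ascPochhammer ℝ n).eval a₂) /
    ((n.factorial : ℝ) * ((ascPochhammer ℝ n).eval (b 0) * (ascPochhammer ℝ n).eval (b 1) *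
      (ascPochhammer ℝ n).eval (b 2))) * z ^ n

/-- The hypergeometric function `₂F₃[a₁, a₂; b₁, b₂, b₃ | z]` of a real argument. -/
noncomputable def twoFThree (a₁ a₂ : ℝ) (b : Fin 3 → ℝ) (z : ℝ) : ℝ :=
  ∑' n : ℕ, twoFThreeTerm a₁ a₂ b z n

/-- For positive parameters the series converges for every argument, so that `twoFThree` is a
genuine sum. -/
theorem summable_twoFThreeTerm {a₁ a₂ : ℝ} {b : Fin 3 → ℝ} (ha₁ : 0 < a₁) (ha₂ : 0 < a₂)
    (hb : ∀ i, 0 < b i) (z : ℝ) : Summable (twoFThreeTerm a₁ a₂ b z) := by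
  rcases eq_or_ne z 0 with rfl | hz
  · refine summable_of_ne_finset_zero (s := {0}) fun n hn => ?_
    have : n ≠ 0 := by simpa using hn
    simp [twoFThreeTerm, this]
  have hpos : ∀ (n : ℕ) (c : ℝ), 0 < c → (ascPochhammer ℝ n).eval c ≠ 0 :=
    fun n c hc => (ascPochhammer_pos n c hc).ne'
  have hne : ∀ n, twoFThreeTerm a₁ a₂ b z n ≠ 0 := fun n => by
    have := hpos n; have hf : (n.factorial : ℝ) ≠ 0 := by positivity
    unfold twoFThreeTerm
    have h0 := this _ (hb 0); have h1 := this _ (hb 1); have h2 := this _ (hb 2)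
    have h3 := this _ ha₁; have h4 := this _ ha₂
    positivity
  have hratio : ∀ n : ℕ, ‖twoFThreeTerm a₁ a₂ b z (n + 1)‖ / ‖twoFThreeTerm a₁ a₂ b z n‖ =
      |(a₁ + n) / (b 0 + n) * ((a₂ + n) / (b 1 + n)) * (z / (b 2 + n)) * (1 / ((n : ℝ) + 1))| := by
    intro n
    rw [← norm_div, Real.norm_eq_abs]
    congr 1
    have := hpos n
    have h0 := this _ (hb 0); have h1 := this _ (hb 1); have h2 := this _ (hb 2)
    have h3 := this _ ha₁; have h4 := this _ ha₂
    have hf : (n.factorial : ℝ) ≠ 0 := by positivity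
    have k0 : b 0 + n ≠ 0 := by have := hb 0; positivity
    have k1 : b 1 + n ≠ 0 := by have := hb 1; positivity
    have k2 : b 2 + n ≠ 0 := by have := hb 2; positivity
    have k3 : (n : ℝ) + 1 ≠ 0 := by positivity
    simp only [twoFThreeTerm, ascPochhammer_succ_eval, Nat.factorial_succ, Nat.cast_mul,
      Nat.cast_add, Nat.cast_one, pow_succ]
    field_simp
  have hlin : ∀ c : ℝ, Filter.Tendsto (fun n : ℕ => c + (n : ℝ)) Filter.atTop Filter.atTop :=
    fun c => Filter.tendsto_atTop_add_const_left _ c tendsto_natCast_atTop_atTop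
  have hone : ∀ c d : ℝ, 0 < d → Filter.Tendsto (fun n : ℕ => (c + n) / (d + n)) Filter.atTop
      (nhds 1) := by
    intro c d hd
    have h : Filter.Tendsto (fun n : ℕ => 1 + (c - d) / (d + (n : ℝ))) Filter.atTop
        (nhds (1 + 0)) := tendsto_const_nhds.add ((hlin d).const_div_atTop _)
    rw [add_zero] at h
    refine h.congr fun n => ?_
    have : d + (n : ℝ) ≠ 0 := by positivity
    field_simp
    ring
  refine summable_of_ratio_test_tendsto_lt_one (l := 0) one_pos
    (Filter.Eventually.of_forall hne) ?_
  simp only [hratio]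
  have h := ((((hone a₁ _ (hb 0)).mul (hone a₂ _ (hb 1))).mul
    ((hlin (b 2)).const_div_atTop z)).mul tendsto_one_div_add_atTop_nhds_zero_nat).abs
  simpa using h

/-- The admissible set `Λ` of pairs `(a₁, a₂)`. -/
def admissible : Set (ℝ × ℝ) :=
  {a | 0 < a.1 ∧ 0 < a.2 ∧
    (a.1 ≤ 1 / 2 →
      a.2 ≤ 1 / 2 * (3 * a.1 + 1 / 2) ∨ (1 ≤ a.2 ∧ a.2 ≤ 2 * a.1 + 1)) ∧
    (1 / 2 ≤ a.1 → a.2 ≤ max (a.1 + 3 / 2) (3 / 2 * (a.1 + 1 / 2)))}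

/-- The point `(a₂, a₁ + 1/2, 2 a₁)`. -/
noncomputable def basePoint (a₁ a₂ : ℝ) : Fin 3 → ℝ := ![a₂, a₁ + 1 / 2, 2 * a₁]

/-- The set `𝒜` of all permutations of `(a₂, a₁ + 1/2, 2 a₁)`. -/
def vertexSet (a₁ a₂ : ℝ) : Set (Fin 3 → ℝ) :=
  Set.range fun σ : Equiv.Perm (Fin 3) => basePoint a₁ a₂ ∘ σ

/-- `ξ 0 ≤ ξ 1 ≤ ξ 2`: the arrangement of `a₂, a₁ + 1/2, 2 a₁` in ascending order
(`ξ₁, ξ₂, ξ₃` when counting from one). -/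
noncomputable def xi (a₁ a₂ : ℝ) : Fin 3 → ℝ :=
  basePoint a₁ a₂ ∘ Tuple.sort (basePoint a₁ a₂)

/-- The Newton polyhedron `Γ₊(E)`: the convex hull of the union of the octants `x + [0, ∞)³`,
`x ∈ E`. The order on `Fin 3 → ℝ` is coordinatewise, so that octant is `Set.Ici x`. -/
def newtonPolyhedron (E : Set (Fin 3 → ℝ)) : Set (Fin 3 → ℝ) :=
  convexHull ℝ (⋃ x ∈ E, Set.Ici x)

/-! Put `t = x ^ 2`. At the point `(a₂, a₁ + 1/2, 2 a₁)` the parameter `a₂` cancels and the function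
is the square of a `₀F₁` (`twoFThree_basePoint`), hence nonnegative; write its series as `∑ c n * t
^ n`. Passing to another `b` divides `c n` by `∏ j < n, P j`, where `P j = ∏ (b i + j) / ∏ (ξ i +
j)`.

Expanding the numerator of `P` in the Newton basis at the nodes `-ξ i` gives `P s = 1 + A / (s + ξ
2) + B / ((s + ξ 1) (s + ξ 2)) + C / ((s + ξ 0) (s + ξ 1) (s + ξ 2))`, and the inequalities defining
the polyhedron force `A, B, C ≥ 0` (`newton_coeff_nonneg`). Dividing coefficients by `n + β` is an
average of the function over dilations, so multiplying by `P (n + k)` preserves nonnegativity.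
Multiplying by `P (n + k) / P k` for all `k < K` turns `c n` into `c n * ∏ j < n, P (K + j) / P j`.
Since `P → 1`, letting `K → ∞` turns these multiplications into the required division
(`NonnegSeries.div_prod_range`).

Strict positivity comes from one average kept outside the limit, available unless `A = B = C = 0`,
that is, unless `b` is a permutation of `ξ`. The description of the polyhedron is a majorization
argument: averaging two coordinates at a time carries `ξ` below any `b` satisfying the inequalities.
-/

/-- Coefficients of an entire power series that is nonnegative on `[0, ∞)`. -/
structure NonnegSeries (c : ℕ → ℝ) : Prop where
  summable : ∀ t : ℝ, Summable fun n => c n * t ^ n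
  nonneg : ∀ t : ℝ, 0 ≤ t → 0 ≤ ∑' n, c n * t ^ n

/-! ### Nonnegative entire series and averages over dilations -/

namespace NonnegSeries

variable {c d : ℕ → ℝ}

theorem summable_of_abs_le (hc : ∀ t : ℝ, Summable fun n => c n * t ^ n)
    (h : ∀ n, |d n| ≤ |c n|) (t : ℝ) : Summable fun n => d n * t ^ n := by
  refine Summable.of_norm_bounded (hc t).abs fun n => ?_
  rw [Real.norm_eq_abs, abs_mul, abs_mul]
  exact mul_le_mul_of_nonneg_right (h n) (abs_nonneg _)

theorem add (hc : NonnegSeries c) (hd : NonnegSeries d) :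
    NonnegSeries fun n => c n + d n where
  summable t := by simpa only [add_mul] using (hc.summable t).add (hd.summable t)
  nonneg t ht := by
    simp only [add_mul]
    rw [(hc.summable t).tsum_add (hd.summable t)]
    exact add_nonneg (hc.nonneg t ht) (hd.nonneg t ht)

theorem const_mul (hc : NonnegSeries c) {a : ℝ} (ha : 0 ≤ a) :
    NonnegSeries fun n => a * c n where
  summable t := by simpa only [mul_assoc] using (hc.summable t).mul_left a
  nonneg t ht := by
    simp only [mul_assoc]
    rw [tsum_mul_left]
    exact mul_nonneg ha (hc.nonneg t ht)

theorem continuous_tsum (hc : ∀ t : ℝ, Summable fun n => c n * t ^ n) :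
    Continuous fun t : ℝ => ∑' n, c n * t ^ n := by
  rw [continuous_iff_continuousAt]
  intro x
  have : ContinuousOn (fun t : ℝ => ∑' n, c n * t ^ n) (Set.Ioo (-(|x| + 1)) (|x| + 1)) := by
    refine continuousOn_tsum (fun n => by fun_prop) (hc (|x| + 1)).abs fun n t ht => ?_
    rw [Real.norm_eq_abs, abs_mul, abs_mul, abs_pow, abs_pow]
    rw [abs_of_pos (by positivity : 0 < |x| + 1)]
    exact mul_le_mul_of_nonneg_left (pow_le_pow_left₀ (abs_nonneg _) (abs_lt.2 ht).le n)
      (abs_nonneg _)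
  refine this.continuousAt (Ioo_mem_nhds ?_ ?_)
  · linarith [neg_abs_le x]
  · linarith [le_abs_self x]

/-- Dividing the coefficients by `n + β` amounts to averaging against `u ^ (β - 1)` on `[0, 1]`. -/
theorem tsum_div_eq_integral (hc : ∀ t : ℝ, Summable fun n => c n * t ^ n) {β : ℝ} (hβ : 0 < β)
    (t : ℝ) :
    ∑' n, c n / (n + β) * t ^ n = ∫ u in (0 : ℝ)..1, u ^ (β - 1) * ∑' n, c n * (u * t) ^ n := by
  have hint : ∫ u in (0 : ℝ)..1, u ^ (β - 1) * ∑' n, c n * (u * t) ^ n =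
      ∑' n, ∫ u in (0 : ℝ)..1, u ^ (β - 1) * (c n * (u * t) ^ n) := by
    refine (HasSum.tsum_eq (intervalIntegral.hasSum_integral_of_dominated_convergence
      (fun n u => u ^ (β - 1) * |c n * t ^ n|) (fun n => ?_) (fun n => ?_) ?_ ?_ ?_)).symm
    · refine Measurable.aestronglyMeasurable ?_
      fun_prop
    · refine Filter.Eventually.of_forall fun u hu => ?_
      rw [Set.uIoc_of_le zero_le_one] at hu
      have hu0 := hu.1.le
      rw [Real.norm_eq_abs, abs_mul, abs_of_nonneg (Real.rpow_nonneg hu0 _)]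
      refine mul_le_mul_of_nonneg_left ?_ (Real.rpow_nonneg hu0 _)
      rw [abs_mul, abs_mul, mul_pow, abs_mul, abs_of_nonneg (pow_nonneg hu0 n)]
      exact mul_le_mul_of_nonneg_left
        (mul_le_of_le_one_left (abs_nonneg _) (pow_le_one₀ hu0 hu.2)) (abs_nonneg _)
    · exact Filter.Eventually.of_forall fun u _ => (hc t).abs.mul_left _
    · simp only [tsum_mul_left]
      exact (intervalIntegral.intervalIntegrable_rpow' (by linarith)).mul_const _
    · exact Filter.Eventually.of_forall fun u _ => (hc (u * t)).hasSum.mul_left _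
  rw [hint]
  refine tsum_congr fun n => ?_
  have hn : ∫ u in (0 : ℝ)..1, u ^ (β - 1) * (c n * (u * t) ^ n) =
      ∫ u in (0 : ℝ)..1, (c n * t ^ n) * u ^ (n + β - 1) := by
    refine intervalIntegral.integral_congr_ae (Filter.Eventually.of_forall fun u hu => ?_)
    rw [Set.uIoc_of_le zero_le_one] at hu
    rw [show (n : ℝ) + β - 1 = (β - 1) + n by ring, Real.rpow_add hu.1, Real.rpow_natCast, mul_pow]
    ring
  have hn' : (0 : ℝ) < n + β := by positivity
  rw [hn, intervalIntegral.integral_const_mul, integral_rpow (Or.inl (by linarith))]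
  simp only [sub_add_cancel, Real.one_rpow, Real.zero_rpow hn'.ne']
  field_simp
  ring

theorem abs_div_le {β : ℝ} (hβ : 0 < β) (n : ℕ) : |c n / (n + β)| ≤ |β⁻¹ * c n| := by
  rw [abs_div, abs_mul, abs_inv, abs_of_pos hβ, abs_of_pos (by positivity : (0 : ℝ) < n + β),
    div_eq_inv_mul]
  gcongr
  simp

theorem summable_div (hc : ∀ t : ℝ, Summable fun n => c n * t ^ n) {β : ℝ} (hβ : 0 < β) (t : ℝ) :
    Summable fun n => c n / (n + β) * t ^ n :=
  summable_of_abs_le (c := fun n => β⁻¹ * c n)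
    (fun t => by simpa only [mul_assoc] using (hc t).mul_left β⁻¹) (abs_div_le hβ) t

theorem div_add (hc : NonnegSeries c) {β : ℝ} (hβ : 0 < β) :
    NonnegSeries fun n => c n / (n + β) where
  summable := summable_div hc.summable hβ
  nonneg t ht := by
    rw [tsum_div_eq_integral hc.summable hβ t]
    refine intervalIntegral.integral_nonneg zero_le_one fun u hu => ?_
    exact mul_nonneg (Real.rpow_nonneg hu.1 _) (hc.nonneg _ (mul_nonneg hu.1 ht))

/-- The averaged function is nonnegative and takes the value `c 0 > 0` at `u = 0`, so by continuity
the integral has a positive contribution near `0`. Zeros of the original function are thereby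
removed. -/
theorem div_add_pos (hc : NonnegSeries c) (h0 : 0 < c 0) {β : ℝ} (hβ : 0 < β) {t : ℝ}
    (ht : 0 ≤ t) : 0 < ∑' n, c n / (n + β) * t ^ n := by
  rw [tsum_div_eq_integral hc.summable hβ t]
  set F : ℝ → ℝ := fun u => ∑' n, c n * (u * t) ^ n with hF
  have hFc : Continuous F :=
    (continuous_tsum hc.summable).comp (by fun_prop : Continuous fun u : ℝ => u * t)
  have hF0 : 0 < F 0 := by
    rw [hF]
    simp only [zero_mul]
    rw [tsum_eq_single 0 (by intro n hn; simp [hn])]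
    simpa using h0
  obtain ⟨ε, hε, hball⟩ :=
    Metric.eventually_nhds_iff.1 (hFc.continuousAt.eventually (lt_mem_nhds hF0))
  set δ := min (ε / 2) 1 with hδ
  have hδ0 : 0 < δ := by positivity
  have hi : ∀ a b : ℝ, IntervalIntegrable (fun u => u ^ (β - 1) * F u) MeasureTheory.volume a b :=
    fun a b => (intervalIntegral.intervalIntegrable_rpow' (by linarith)).mul_continuousOn
      hFc.continuousOn
  rw [← intervalIntegral.integral_add_adjacent_intervals (hi 0 δ) (hi δ 1)]
  refine add_pos_of_pos_of_nonneg ?_ ?_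
  · refine intervalIntegral.intervalIntegral_pos_of_pos_on (hi 0 δ) (fun u hu => ?_) hδ0
    refine mul_pos (Real.rpow_pos_of_pos hu.1 _) (hball ?_)
    rw [Real.dist_eq, sub_zero, abs_of_pos hu.1]
    linarith [hu.2, min_le_left (ε / 2) 1]
  · refine intervalIntegral.integral_nonneg (min_le_right _ _) fun u hu => ?_
    have hu0 : 0 ≤ u := hδ0.le.trans hu.1
    exact mul_nonneg (Real.rpow_nonneg hu0 _) (hc.nonneg _ (mul_nonneg hu0 ht))

end NonnegSeries

/-! ### Multiplying and dividing coefficients by a Newton-form ratio -/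

section

open Filter Topology Finset

/-- The rational function `1 + A / (s + z) + B / ((s + y) (s + z)) + C / ((s + x) (s + y) (s + z))`,
a monic cubic over `(s + x) (s + y) (s + z)` with the numerator in Newton form. -/
noncomputable def newtonRatio (A B C x y z s : ℝ) : ℝ :=
  1 + A / (s + z) + B / ((s + y) * (s + z)) + C / ((s + x) * (s + y) * (s + z))

section newtonRatio

variable {A B C x y z : ℝ}

theorem newtonRatio_add_one (s : ℝ) :
    newtonRatio A B C x y z (s + 1) = newtonRatio A B C (x + 1) (y + 1) (z + 1) s := by
  simp only [newtonRatio, add_assoc, add_comm (1 : ℝ)]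

theorem one_le_newtonRatio (hA : 0 ≤ A) (hB : 0 ≤ B) (hC : 0 ≤ C) (hx : 0 < x) (hy : 0 < y)
    (hz : 0 < z) {s : ℝ} (hs : 0 ≤ s) : 1 ≤ newtonRatio A B C x y z s := by
  have : 0 ≤ A / (s + z) + B / ((s + y) * (s + z)) + C / ((s + x) * (s + y) * (s + z)) := by
    positivity
  unfold newtonRatio
  linarith

theorem newtonRatio_anti (hA : 0 ≤ A) (hB : 0 ≤ B) (hC : 0 ≤ C) (hx : 0 < x) (hy : 0 < y)
    (hz : 0 < z) {s t : ℝ} (hs : 0 ≤ s) (hst : s ≤ t) :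
    newtonRatio A B C x y z t ≤ newtonRatio A B C x y z s := by
  have ht : 0 ≤ t := hs.trans hst
  unfold newtonRatio
  gcongr

theorem tendsto_newtonRatio :
    Tendsto (fun n : ℕ => newtonRatio A B C x y z n) atTop (𝓝 1) := by
  have hlin (w : ℝ) : Tendsto (fun n : ℕ => (n : ℝ) + w) atTop atTop :=
    tendsto_atTop_add_const_right _ w tendsto_natCast_atTop_atTop
  have h1 : Tendsto (fun n : ℕ => A / ((n : ℝ) + z)) atTop (𝓝 0) := (hlin z).const_div_atTop _
  have h2 : Tendsto (fun n : ℕ => B / (((n : ℝ) + y) * (n + z))) atTop (𝓝 0) :=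
    ((hlin y).atTop_mul_atTop₀ (hlin z)).const_div_atTop _
  have h3 : Tendsto (fun n : ℕ => C / (((n : ℝ) + x) * (n + y) * (n + z))) atTop (𝓝 0) :=
    (((hlin x).atTop_mul_atTop₀ (hlin y)).atTop_mul_atTop₀ (hlin z)).const_div_atTop _
  simpa [newtonRatio] using ((h1.const_add 1).add h2).add h3

end newtonRatio

namespace NonnegSeries

variable {c : ℕ → ℝ} {A B C x y z : ℝ}

/-- Each term of the Newton form is a nonnegative multiple of an iterated division by `n + β`, with
`β` one of `k + z`, `k + y`, `k + x`. -/
theorem mul_newtonRatio (hc : NonnegSeries c) (hA : 0 ≤ A) (hB : 0 ≤ B) (hC : 0 ≤ C) (hx : 0 < x)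
    (hy : 0 < y) (hz : 0 < z) (k : ℕ) :
    NonnegSeries fun n => c n * newtonRatio A B C x y z (n + k : ℕ) := by
  have hxk : 0 < k + x := by positivity
  have hyk : 0 < k + y := by positivity
  have hzk : 0 < k + z := by positivity
  have h := ((hc.add ((hc.div_add hzk).const_mul hA)).add
    (((hc.div_add hzk).div_add hyk).const_mul hB)).add
    ((((hc.div_add hzk).div_add hyk).div_add hxk).const_mul hC)
  convert h using 2 with n
  have h1 : (n : ℝ) + (k + x) ≠ 0 := by positivity
  have h2 : (n : ℝ) + (k + y) ≠ 0 := by positivity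
  have h3 : (n : ℝ) + (k + z) ≠ 0 := by positivity
  simp only [newtonRatio, Nat.cast_add, add_assoc]
  field_simp

theorem mul_newtonRatio_pos (hc : NonnegSeries c) (h0 : 0 < c 0) (hA : 0 ≤ A) (hB : 0 ≤ B)
    (hC : 0 ≤ C) (hABC : 0 < A + B + C) (hx : 0 < x) (hy : 0 < y) (hz : 0 < z) {t : ℝ}
    (ht : 0 ≤ t) : 0 < ∑' n, c n * newtonRatio A B C x y z n * t ^ n := by
  have hcz := hc.div_add hz
  have hcy := hcz.div_add hy
  have hcx := hcy.div_add hx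
  have pz := hc.div_add_pos h0 hz ht
  have py := hcz.div_add_pos (by simp; positivity) hy ht
  have px := hcy.div_add_pos (by simp; positivity) hx ht
  have key : ∑' n, c n * newtonRatio A B C x y z n * t ^ n =
      ∑' n, c n * t ^ n + A * ∑' n, c n / (n + z) * t ^ n +
        B * ∑' n, c n / (n + z) / (n + y) * t ^ n +
        C * ∑' n, c n / (n + z) / (n + y) / (n + x) * t ^ n := by
    simp only [← tsum_mul_left]
    have s0 := hc.summable t
    have sz := (hcz.summable t).mul_left A
    have sy := (hcy.summable t).mul_left B
    have sx := (hcx.summable t).mul_left C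
    rw [← s0.tsum_add sz, ← (s0.add sz).tsum_add sy, ← ((s0.add sz).add sy).tsum_add sx]
    refine tsum_congr fun n => ?_
    have h1 : (n : ℝ) + x ≠ 0 := by positivity
    have h2 : (n : ℝ) + y ≠ 0 := by positivity
    have h3 : (n : ℝ) + z ≠ 0 := by positivity
    simp only [newtonRatio]
    field_simp
  rw [key]
  have p0 := hc.nonneg t ht
  have qA := mul_nonneg hA pz.le
  have qB := mul_nonneg hB py.le
  have qC := mul_nonneg hC px.le
  rcases hA.lt_or_eq with hA | rfl
  · linarith [mul_pos hA pz]
  rcases hB.lt_or_eq with hB | rfl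
  · linarith [mul_pos hB py]
  have hC : 0 < C := by linarith
  linarith [mul_pos hC px]

/-- If multiplying coefficients by each shift of `P` preserves nonnegativity and `P` decreases
to `1`, then dividing by the products of `P` preserves nonnegativity. -/
theorem div_prod_range {P : ℕ → ℝ} (hc : NonnegSeries c) (h1 : ∀ n, 1 ≤ P n) (hanti : Antitone P)
    (hlim : Tendsto P atTop (𝓝 1))
    (hP : ∀ d : ℕ → ℝ, NonnegSeries d → ∀ k, NonnegSeries fun n => d n * P (n + k)) :
    NonnegSeries fun n => c n / ∏ j ∈ range n, P j := by
  have hpos : ∀ n, 0 < P n := fun n => one_pos.trans_le (h1 n)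
  have hprod : ∀ n, 0 < ∏ j ∈ range n, P j := fun n => prod_pos fun j _ => hpos j
  have hfin : ∀ K, NonnegSeries fun n => c n * ∏ k ∈ range K, P (n + k) := by
    intro K
    induction K with
    | zero => simpa using hc
    | succ K ih => simpa only [prod_range_succ, mul_assoc] using hP _ ih K
  -- Both ways of splitting `∏ i < n + K, P i` agree, so the `K` normalised multiplications leave
  -- only `n` factors near infinity over the `n` wanted ones.
  have hswap : ∀ K n, (∏ k ∈ range K, P k)⁻¹ * (c n * ∏ k ∈ range K, P (n + k)) =
      c n * ((∏ j ∈ range n, P (K + j)) / ∏ j ∈ range n, P j) := by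
    intro K n
    have h : (∏ j ∈ range n, P j) * ∏ k ∈ range K, P (n + k) =
        (∏ k ∈ range K, P k) * ∏ j ∈ range n, P (K + j) := by
      rw [← prod_range_add, ← prod_range_add, add_comm]
    have hK := (hprod K).ne'
    have hn := (hprod n).ne'
    field_simp
    rw [mul_assoc, mul_comm (∏ k ∈ range K, P (n + k)), h]
    ring
  have hsum : ∀ t : ℝ, Summable fun n => c n / (∏ j ∈ range n, P j) * t ^ n := by
    refine summable_of_abs_le hc.summable fun n => ?_
    rw [abs_div, abs_of_pos (hprod n)]
    exact div_le_self (abs_nonneg _) (one_le_prod fun j _ => h1 j)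
  refine ⟨hsum, fun t ht => ?_⟩
  have hconv : Tendsto
      (fun K => ∑' n, c n * ((∏ j ∈ range n, P (K + j)) / ∏ j ∈ range n, P j) * t ^ n) atTop
      (𝓝 (∑' n, c n / (∏ j ∈ range n, P j) * t ^ n)) := by
    -- As `P` is antitone and positive, the quotient of products is at most `1`, so `|c n * t ^ n|`
    -- dominates uniformly in `K`.
    refine tendsto_tsum_of_dominated_convergence (hc.summable t).abs (fun n => ?_)
      (Eventually.of_forall fun K n => ?_)
    · have hone : Tendsto (fun K => ∏ j ∈ range n, P (K + j)) atTop (𝓝 1) := by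
        simpa using tendsto_finsetProd (range n) fun j _ => hlim.comp (tendsto_add_atTop_nat j)
      simpa [div_eq_mul_inv] using
        (((hone.div_const (∏ j ∈ range n, P j)).const_mul (c n)).mul_const (t ^ n))
    · have hle : (∏ j ∈ range n, P (K + j)) / ∏ j ∈ range n, P j ≤ 1 :=
        (div_le_one (hprod n)).2
          (prod_le_prod (fun j _ => (hpos _).le) fun j _ => hanti (Nat.le_add_left j K))
      have hge : 0 ≤ (∏ j ∈ range n, P (K + j)) / ∏ j ∈ range n, P j :=
        div_nonneg (prod_nonneg fun j _ => (hpos _).le) (hprod n).le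
      rw [Real.norm_eq_abs, abs_mul, abs_mul, abs_mul, abs_of_nonneg hge]
      exact mul_le_mul_of_nonneg_right (mul_le_of_le_one_right (abs_nonneg _) hle) (abs_nonneg _)
  refine ge_of_tendsto' hconv fun K => ?_
  simp only [← hswap]
  exact ((hfin K).const_mul (inv_nonneg.2 (hprod K).le)).nonneg t ht

theorem div_prod_newtonRatio (hc : NonnegSeries c) (hA : 0 ≤ A) (hB : 0 ≤ B) (hC : 0 ≤ C)
    (hx : 0 < x) (hy : 0 < y) (hz : 0 < z) :
    NonnegSeries fun n => c n / ∏ j ∈ range n, newtonRatio A B C x y z j :=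
  hc.div_prod_range (P := fun n : ℕ => newtonRatio A B C x y z n)
    (fun n => one_le_newtonRatio hA hB hC hx hy hz n.cast_nonneg)
    (fun m _ hmn => newtonRatio_anti hA hB hC hx hy hz m.cast_nonneg (Nat.cast_le.2 hmn))
    tendsto_newtonRatio fun _ hd k => hd.mul_newtonRatio hA hB hC hx hy hz k

/-- A limit yields only `≥ 0`. Instead, division by the products of the shifted ratio `P (j + 1)` is
carried out first, and the telescoping identity `∏ P (j + 1) * P 0 = ∏ P j * P n` leaves one
multiplication by `P n`, whose averages are strictly positive. -/
theorem div_prod_newtonRatio_pos (hc : NonnegSeries c) (h0 : 0 < c 0) (hA : 0 ≤ A) (hB : 0 ≤ B)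
    (hC : 0 ≤ C) (hABC : 0 < A + B + C) (hx : 0 < x) (hy : 0 < y) (hz : 0 < z) {t : ℝ}
    (ht : 0 ≤ t) : 0 < ∑' n, c n / (∏ j ∈ range n, newtonRatio A B C x y z j) * t ^ n := by
  set P : ℕ → ℝ := fun n => newtonRatio A B C x y z n with hPdef
  have hpos : ∀ n, 0 < P n := fun n =>
    one_pos.trans_le (one_le_newtonRatio hA hB hC hx hy hz n.cast_nonneg)
  have hshift := hc.div_prod_newtonRatio hA hB hC (add_pos hx one_pos) (add_pos hy one_pos)
    (add_pos hz one_pos)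
  have h := hshift.mul_newtonRatio_pos (by simpa using h0) hA hB hC hABC hx hy hz ht
  have key : ∀ n : ℕ, c n / (∏ j ∈ range n, P j) * t ^ n =
      (P 0)⁻¹ * (c n / (∏ j ∈ range n, newtonRatio A B C (x + 1) (y + 1) (z + 1) j) *
        newtonRatio A B C x y z n * t ^ n) := by
    intro n
    have hs : ∏ j ∈ range n, newtonRatio A B C (x + 1) (y + 1) (z + 1) j =
        ∏ j ∈ range n, P (j + 1) :=
      prod_congr rfl fun j _ => by simp [hPdef, newtonRatio_add_one]
    have hp : (∏ j ∈ range n, P (j + 1)) * P 0 = (∏ j ∈ range n, P j) * P n := by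
      rw [← prod_range_succ', prod_range_succ]
    have q1 : ∏ j ∈ range n, P (j + 1) ≠ 0 := (prod_pos fun j _ => hpos _).ne'
    have q2 : ∏ j ∈ range n, P j ≠ 0 := (prod_pos fun j _ => hpos _).ne'
    have q3 := (hpos 0).ne'
    rw [hs, show newtonRatio A B C x y z n = P n from rfl]
    field_simp
    linear_combination c n * t ^ n * hp
  have hsum : ∑' n, c n / (∏ j ∈ range n, P j) * t ^ n = _ := tsum_congr key
  rw [tsum_mul_left] at hsum
  rw [hsum]
  exact mul_pos (inv_pos.2 (hpos 0)) h

end NonnegSeries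

end

/-! ### Pochhammer identities and the square of a `₀F₁` -/

section

open Finset

theorem ascPochhammer_eval_eq_prod_range (n : ℕ) (c : ℝ) :
    (ascPochhammer ℝ n).eval c = ∏ j ∈ range n, (c + j) := by
  induction n with
  | zero => simp
  | succ n ih => rw [ascPochhammer_succ_eval, prod_range_succ, ih]

theorem ascPochhammer_eval_add (m n : ℕ) (c : ℝ) :
    (ascPochhammer ℝ (m + n)).eval c =
      (ascPochhammer ℝ m).eval c * (ascPochhammer ℝ n).eval (c + m) := by
  simp [← ascPochhammer_mul]

theorem pow_le_ascPochhammer_eval (n : ℕ) {c : ℝ} (hc : 0 < c) :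
    c ^ n ≤ (ascPochhammer ℝ n).eval c := by
  rw [ascPochhammer_eval_eq_prod_range, ← card_range n, ← prod_const, card_range]
  exact prod_le_prod (fun _ _ => hc.le) fun j _ => by simp

/-- Legendre's duplication formula for Pochhammer symbols. -/
theorem ascPochhammer_eval_two_mul (n : ℕ) (a : ℝ) :
    (ascPochhammer ℝ (2 * n)).eval (2 * a) =
      4 ^ n * (ascPochhammer ℝ n).eval a * (ascPochhammer ℝ n).eval (a + 1 / 2) := by
  induction n with
  | zero => simp
  | succ n ih =>
    rw [show 2 * (n + 1) = 2 * n + 1 + 1 by ring]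
    simp only [ascPochhammer_succ_eval, ih]
    push_cast
    ring

theorem descPochhammer_smeval_eq_ascPochhammer_eval (n : ℕ) (r : ℝ) :
    (descPochhammer ℤ n).smeval r = (ascPochhammer ℝ n).eval (r - n + 1) := by
  rw [← descPochhammer_eval_eq_ascPochhammer, ← Polynomial.aeval_eq_smeval, Polynomial.aeval_def,
    ← descPochhammer_map (algebraMap ℤ ℝ), Polynomial.eval_map]

/-- For `i + j = n`, the symbol `(c + j)ᵢ` is the falling factorial of `c + n - 1` of order `i`;
this is the Chu–Vandermonde identity with both arguments equal to `c + n - 1`. -/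
theorem sum_choose_mul_ascPochhammer (n : ℕ) (c : ℝ) :
    ∑ ij ∈ antidiagonal n, (n.choose ij.1 : ℝ) *
      ((ascPochhammer ℝ ij.1).eval (c + ij.2) * (ascPochhammer ℝ ij.2).eval (c + ij.1)) =
      (ascPochhammer ℝ n).eval (2 * c + n - 1) := by
  have h := Ring.descPochhammer_smeval_add n (Commute.all (c + n - 1) (c + n - 1))
  simp only [descPochhammer_smeval_eq_ascPochhammer_eval] at h
  rw [show 2 * c + n - 1 = c + n - 1 + (c + n - 1) - n + 1 by ring, h]
  refine sum_congr rfl fun ij hij => ?_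
  have hn : (n : ℝ) = ij.1 + ij.2 := by exact_mod_cast (mem_antidiagonal.1 hij).symm
  rw [hn]
  ring_nf

/-- The Cauchy square of the series `∑ zⁿ / (n! (a + 1/2)ₙ)`. -/
theorem sum_antidiagonal_zeroFOne (n : ℕ) {a : ℝ} (ha : 0 < a) (z : ℝ) :
    ∑ ij ∈ antidiagonal n,
      ((z / 4) ^ ij.1 / (ij.1.factorial * (ascPochhammer ℝ ij.1).eval (a + 1 / 2))) *
      ((z / 4) ^ ij.2 / (ij.2.factorial * (ascPochhammer ℝ ij.2).eval (a + 1 / 2))) =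
      (ascPochhammer ℝ n).eval a /
        (n.factorial * ((ascPochhammer ℝ n).eval (a + 1 / 2) * (ascPochhammer ℝ n).eval (2 * a))) *
        z ^ n := by
  have hp : ∀ (m : ℕ) {c : ℝ}, 0 < c → (ascPochhammer ℝ m).eval c ≠ 0 :=
    fun m c hc => (ascPochhammer_pos m c hc).ne'
  have hc : 0 < a + 1 / 2 := by positivity
  -- From `(c)ₙ = (c)ᵢ (c + i)ⱼ = (c)ⱼ (c + j)ᵢ` it follows that `1 / ((c)ᵢ (c)ⱼ) = (c + i)ⱼ (c +
  -- j)ᵢ / (c)ₙ²`, which brings the sum to Vandermonde form.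
  have hterm : ∀ ij ∈ antidiagonal n,
      ((z / 4) ^ ij.1 / (ij.1.factorial * (ascPochhammer ℝ ij.1).eval (a + 1 / 2))) *
      ((z / 4) ^ ij.2 / (ij.2.factorial * (ascPochhammer ℝ ij.2).eval (a + 1 / 2))) =
      (z / 4) ^ n / (n.factorial * (ascPochhammer ℝ n).eval (a + 1 / 2) ^ 2) *
        ((n.choose ij.1 : ℝ) * ((ascPochhammer ℝ ij.1).eval (a + 1 / 2 + ij.2) *
          (ascPochhammer ℝ ij.2).eval (a + 1 / 2 + ij.1))) := by
    rintro ⟨i, j⟩ hij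
    obtain rfl : i + j = n := mem_antidiagonal.1 hij
    have h1 := ascPochhammer_eval_add i j (a + 1 / 2)
    have h2 := ascPochhammer_eval_add j i (a + 1 / 2)
    rw [add_comm j i] at h2
    have hi := hp i hc
    have hj := hp j hc
    have hij := hp (i + j) hc
    have hch : ((i + j).choose i : ℝ) * i.factorial * j.factorial = (i + j).factorial := by
      rw [Nat.choose_symm_add]
      exact_mod_cast Nat.add_choose_mul_factorial_mul_factorial i j
    have hi' : (i.factorial : ℝ) ≠ 0 := by positivity
    have hj' : (j.factorial : ℝ) ≠ 0 := by positivity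
    have hn' : ((i + j).factorial : ℝ) ≠ 0 := by positivity
    have e1 : (ascPochhammer ℝ j).eval (a + 1 / 2 + i) =
        (ascPochhammer ℝ (i + j)).eval (a + 1 / 2) / (ascPochhammer ℝ i).eval (a + 1 / 2) :=
      eq_div_of_mul_eq hi (by rw [h1, mul_comm])
    have e2 : (ascPochhammer ℝ i).eval (a + 1 / 2 + j) =
        (ascPochhammer ℝ (i + j)).eval (a + 1 / 2) / (ascPochhammer ℝ j).eval (a + 1 / 2) :=
      eq_div_of_mul_eq hj (by rw [h2, mul_comm])
    have e3 : ((i + j).choose i : ℝ) = (i + j).factorial / (i.factorial * j.factorial) := by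
      rw [← hch]; field_simp
    simp only [e1, e2, e3]
    rw [pow_add]
    generalize (ascPochhammer ℝ (i + j)).eval (a + 1 / 2) = u at *
    generalize (ascPochhammer ℝ i).eval (a + 1 / 2) = v at *
    generalize (ascPochhammer ℝ j).eval (a + 1 / 2) = w at *
    generalize (z / 4) ^ i = p
    generalize (z / 4) ^ j = q
    field_simp
  rw [sum_congr rfl hterm, ← mul_sum, sum_choose_mul_ascPochhammer,
    show 2 * (a + 1 / 2) + (n : ℝ) - 1 = 2 * a + n by ring]
  -- The Vandermonde sum is `(2a + n)ₙ = (2a)₂ₙ / (2a)ₙ`; the `4 ^ n` from duplication cancels the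
  -- one in `(z / 4) ^ n`.
  have hdup := ascPochhammer_eval_two_mul n a
  rw [two_mul n, ascPochhammer_eval_add] at hdup
  have h1 := hp n hc
  have h2 := hp n (by positivity : 0 < 2 * a)
  have hn : (n.factorial : ℝ) ≠ 0 := by positivity
  have e : (ascPochhammer ℝ n).eval (2 * a + n) =
      4 ^ n * (ascPochhammer ℝ n).eval a * (ascPochhammer ℝ n).eval (a + 1 / 2) /
        (ascPochhammer ℝ n).eval (2 * a) := by
    rw [← hdup]; field_simp
  rw [e, div_pow]
  generalize (ascPochhammer ℝ n).eval (a + 1 / 2) = u at *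
  generalize (ascPochhammer ℝ n).eval (2 * a) = v at *
  field_simp

theorem summable_zeroFOne {c : ℝ} (hc : 0 < c) (z : ℝ) :
    Summable fun n : ℕ => ‖z ^ n / (n.factorial * (ascPochhammer ℝ n).eval c)‖ := by
  refine Summable.of_nonneg_of_le (fun n => norm_nonneg _) (fun n => ?_)
    (Real.summable_pow_div_factorial (|z| / c))
  have hp := ascPochhammer_pos n c hc
  rw [norm_div, norm_mul, norm_pow, Real.norm_natCast, Real.norm_eq_abs, Real.norm_of_nonneg hp.le,
    div_pow, div_div, mul_comm (c ^ n)]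
  gcongr
  exact pow_le_ascPochhammer_eval n hc

/-- At the base point `₂F₃` is the square of a `₀F₁`, that is, of a normalised Bessel function. -/
theorem twoFThree_basePoint {a₁ a₂ : ℝ} (ha₁ : 0 < a₁) (ha₂ : 0 < a₂) (z : ℝ) :
    twoFThree a₁ a₂ (basePoint a₁ a₂) z =
      (∑' n : ℕ, (z / 4) ^ n / (n.factorial * (ascPochhammer ℝ n).eval (a₁ + 1 / 2))) ^ 2 := by
  have hs := summable_zeroFOne (by positivity : 0 < a₁ + 1 / 2) (z / 4)
  rw [sq, tsum_mul_tsum_eq_tsum_sum_antidiagonal_of_summable_norm hs hs]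
  refine tsum_congr fun n => ?_
  rw [sum_antidiagonal_zeroFOne n ha₁ z]
  have h2 := (ascPochhammer_pos n a₂ ha₂).ne'
  simp only [twoFThreeTerm, basePoint, Matrix.cons_val]
  congr 1
  rw [mul_assoc ((ascPochhammer ℝ n).eval a₂), mul_left_comm (n.factorial : ℝ), mul_comm,
    mul_div_mul_left _ _ h2]

end

/-! ### Signs and common vanishing of the Newton coefficients -/

/-- The expression is the middle Newton coefficient `B`. It is symmetric in the `bᵢ`, so they may be
sorted; with `u ≤ v ≤ w` the differences `bᵢ - x` and `d = y - x`, it equals `u v + (w - d) (u + v -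
d)`, used for `d ≤ v`, and `(w - v) (u + v - d) + (u + v - d)² + u (d - u)`, used for `v ≤ d`. -/
theorem newton_coeff_nonneg {b₀ b₁ b₂ x y : ℝ} (h₀ : x ≤ b₀) (h₁ : x ≤ b₁) (h₂ : x ≤ b₂)
    (h₀₁ : x + y ≤ b₀ + b₁) (h₁₂ : x + y ≤ b₁ + b₂) (h₀₂ : x + y ≤ b₀ + b₂) (hxy : x ≤ y) :
    0 ≤ (b₀ - x) * (b₁ - x) + (b₁ - x) * (b₂ - x) + (b₀ - x) * (b₂ - x) -
      (y - x) * (b₀ - x + (b₁ - x) + (b₂ - x)) + (y - x) ^ 2 := by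
  have main : ∀ u v w d : ℝ, 0 ≤ u → u ≤ v → v ≤ w → 0 ≤ d → d ≤ u + v →
      0 ≤ u * v + v * w + u * w - d * (u + v + w) + d ^ 2 := by
    intro u v w d hu huv hvw hd hd'
    have he : 0 ≤ u + v - d := by linarith
    rcases le_total d v with h | h
    · linarith [mul_nonneg hu (hu.trans huv), mul_nonneg he (by linarith : 0 ≤ w - d)]
    · linarith [mul_nonneg (by linarith : 0 ≤ w - v) he, sq_nonneg (u + v - d),
        mul_nonneg hu (by linarith : 0 ≤ d - u)]
  have hd : 0 ≤ y - x := by linarith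
  rcases le_total b₀ b₁ with h | h <;> rcases le_total b₁ b₂ with h' | h' <;>
    rcases le_total b₀ b₂ with h'' | h''
  · linarith [main (b₀ - x) (b₁ - x) (b₂ - x) (y - x) (by linarith) (by linarith) (by linarith) hd
      (by linarith)]
  · linarith [main (b₀ - x) (b₁ - x) (b₂ - x) (y - x) (by linarith) (by linarith) (by linarith) hd
      (by linarith)]
  · linarith [main (b₀ - x) (b₂ - x) (b₁ - x) (y - x) (by linarith) (by linarith) (by linarith) hd
      (by linarith)]
  · linarith [main (b₂ - x) (b₀ - x) (b₁ - x) (y - x) (by linarith) (by linarith) (by linarith) hd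
      (by linarith)]
  · linarith [main (b₁ - x) (b₀ - x) (b₂ - x) (y - x) (by linarith) (by linarith) (by linarith) hd
      (by linarith)]
  · linarith [main (b₁ - x) (b₂ - x) (b₀ - x) (y - x) (by linarith) (by linarith) (by linarith) hd
      (by linarith)]
  · linarith [main (b₂ - x) (b₁ - x) (b₀ - x) (y - x) (by linarith) (by linarith) (by linarith) hd
      (by linarith)]
  · linarith [main (b₂ - x) (b₁ - x) (b₀ - x) (y - x) (by linarith) (by linarith) (by linarith) hd
      (by linarith)]

/-- When all Newton coefficients vanish, the cubics with roots `-b i` and `-ξ i` coincide.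
Concretely, `C = 0` makes some `b i` equal to `ξ 0`, then `B` factors as the product of the other
two `b j - ξ 1`, and `A = 0` fixes the last coordinate. -/
theorem exists_perm_of_newton_coeff_eq_zero {b ξ : Fin 3 → ℝ}
    (hC : (b 0 - ξ 0) * (b 1 - ξ 0) * (b 2 - ξ 0) = 0)
    (hB : (b 0 - ξ 0) * (b 1 - ξ 0) + (b 1 - ξ 0) * (b 2 - ξ 0) + (b 0 - ξ 0) * (b 2 - ξ 0) -
      (ξ 1 - ξ 0) * (b 0 - ξ 0 + (b 1 - ξ 0) + (b 2 - ξ 0)) + (ξ 1 - ξ 0) ^ 2 = 0)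
    (hA : b 0 + b 1 + b 2 - (ξ 0 + ξ 1 + ξ 2) = 0) :
    ∃ σ : Equiv.Perm (Fin 3), ξ ∘ σ = b := by
  have mk : ∀ σ : Equiv.Perm (Fin 3), b 0 = ξ (σ 0) → b 1 = ξ (σ 1) → b 2 = ξ (σ 2) →
      ∃ σ : Equiv.Perm (Fin 3), ξ ∘ σ = b := fun σ h0 h1 h2 =>
    ⟨σ, funext fun i => by fin_cases i <;> simp [h0, h1, h2]⟩
  rcases mul_eq_zero.1 hC with hC | h2
  · rcases mul_eq_zero.1 hC with h0 | h1
    · have : (b 1 - ξ 1) * (b 2 - ξ 1) = 0 := by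
        linear_combination hB - (b 1 + b 2 - ξ 0 - ξ 1) * h0
      rcases mul_eq_zero.1 this with h | h
      · exact mk 1 (by simp; linarith) (by simp; linarith) (by simp; linarith)
      · exact mk (Equiv.swap 1 2) (by rw [show Equiv.swap (1 : Fin 3) 2 0 = 0 by decide]; linarith)
          (by rw [show Equiv.swap (1 : Fin 3) 2 1 = 2 by decide]; linarith)
          (by rw [show Equiv.swap (1 : Fin 3) 2 2 = 1 by decide]; linarith)
    · have : (b 0 - ξ 1) * (b 2 - ξ 1) = 0 := by
        linear_combination hB - (b 0 + b 2 - ξ 0 - ξ 1) * h1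
      rcases mul_eq_zero.1 this with h | h
      · exact mk (Equiv.swap 0 1) (by rw [show Equiv.swap (0 : Fin 3) 1 0 = 1 by decide]; linarith)
          (by rw [show Equiv.swap (0 : Fin 3) 1 1 = 0 by decide]; linarith)
          (by rw [show Equiv.swap (0 : Fin 3) 1 2 = 2 by decide]; linarith)
      · exact mk (finRotate 3).symm (by rw [show (finRotate 3).symm 0 = 2 by decide]; linarith)
          (by rw [show (finRotate 3).symm 1 = 0 by decide]; linarith)
          (by rw [show (finRotate 3).symm 2 = 1 by decide]; linarith)
  · have : (b 0 - ξ 1) * (b 1 - ξ 1) = 0 := by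
      linear_combination hB - (b 0 + b 1 - ξ 0 - ξ 1) * h2
    rcases mul_eq_zero.1 this with h | h
    · exact mk (finRotate 3) (by rw [show finRotate 3 0 = 1 by decide]; linarith)
        (by rw [show finRotate 3 1 = 2 by decide]; linarith)
        (by rw [show finRotate 3 2 = 0 by decide]; linarith)
    · exact mk (Equiv.swap 0 2) (by rw [show Equiv.swap (0 : Fin 3) 2 0 = 2 by decide]; linarith)
        (by rw [show Equiv.swap (0 : Fin 3) 2 1 = 1 by decide]; linarith)
        (by rw [show Equiv.swap (0 : Fin 3) 2 2 = 0 by decide]; linarith)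

/-! ### The Newton polyhedron by majorization -/

theorem isUpperSet_newtonPolyhedron (E : Set (Fin 3 → ℝ)) : IsUpperSet (newtonPolyhedron E) := by
  intro b b' hbb' hb
  have hsub : newtonPolyhedron E ⊆ (fun u => u + (b' - b)) ⁻¹' newtonPolyhedron E := by
    refine convexHull_min (fun u hu => subset_convexHull ℝ _ ?_)
      ((convex_convexHull ℝ _).translate_preimage_left _)
    simp only [Set.mem_iUnion, Set.mem_Ici] at hu ⊢
    obtain ⟨x, hx, hxu⟩ := hu
    exact ⟨x, hx, hxu.trans (le_add_of_nonneg_right (sub_nonneg.2 hbb'))⟩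
  simpa using hsub hb

theorem comp_perm_mem_newtonPolyhedron {E : Set (Fin 3 → ℝ)} (σ : Equiv.Perm (Fin 3))
    (hE : ∀ x ∈ E, x ∘ σ ∈ E) {b : Fin 3 → ℝ} (hb : b ∈ newtonPolyhedron E) :
    b ∘ σ ∈ newtonPolyhedron E := by
  have hsub : newtonPolyhedron E ⊆ LinearMap.funLeft ℝ ℝ σ ⁻¹' newtonPolyhedron E := by
    refine convexHull_min (fun u hu => subset_convexHull ℝ _ ?_)
      ((convex_convexHull ℝ _).linear_preimage _)
    simp only [Set.mem_iUnion, Set.mem_Ici] at hu ⊢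
    obtain ⟨x, hx, hxu⟩ := hu
    exact ⟨x ∘ σ, hE x hx, fun i => hxu (σ i)⟩
  exact hsub hb

/-- One averaging of two coordinates: a convex combination of `(p, q)` and `(q, p)` keeps the sum
and moves the first entry anywhere in `[p, q]`; the upper set property does the rest. -/
theorem mem_of_pair_le {S : Set (Fin 3 → ℝ)} (hconv : Convex ℝ S) (hup : IsUpperSet S)
    (hswap : ∀ x p q : ℝ, ![x, p, q] ∈ S → ![x, q, p] ∈ S) {x p q y z : ℝ} (h : ![x, p, q] ∈ S)
    (hpq : p ≤ q) (hy : p ≤ y) (hz : p ≤ z) (hyz : p + q ≤ y + z) : ![x, y, z] ∈ S := by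
  -- The target `y` may exceed `q`, outside the reach of averaging, so it is truncated at `q`.
  obtain ⟨α, β, hα, hβ, hαβ, he⟩ : min y q ∈ segment ℝ p q := by
    rw [segment_eq_Icc hpq]
    exact ⟨le_min hy hpq, min_le_right _ _⟩
  refine hup ?_ (hconv h (hswap x p q h) hα hβ hαβ)
  simp only [smul_eq_mul] at he
  have h1 : α * x + β * x = x := by rw [← add_mul, hαβ, one_mul]
  have h2 : α * q + β * p = p + q - min y q := by
    rw [← he]; linear_combination (p + q) * hαβ
  intro i
  fin_cases i
  · simp [h1]
  · simp [he]
  · simp only [Fin.reduceFinMk, Pi.add_apply, Pi.smul_apply, Matrix.cons_val, smul_eq_mul, h2]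
    rcases min_choice y q with h | h <;> rw [h] <;> linarith

/-- Two averagings suffice: the first creates the coordinate `b 0` from the pair of consecutive `ξ
i` that brackets it, the second adjusts the remaining two coordinates. If `b 0 ≥ ξ 2`, then `b`
already dominates `ξ`. -/
theorem mem_of_sorted {S : Set (Fin 3 → ℝ)} (hconv : Convex ℝ S) (hup : IsUpperSet S)
    (hperm : ∀ σ : Equiv.Perm (Fin 3), ∀ b ∈ S, b ∘ σ ∈ S) {ξ b : Fin 3 → ℝ} (hξ : ξ ∈ S)
    (hξm : Monotone ξ) (hbm : Monotone b) (h₁ : ξ 0 ≤ b 0) (h₂ : ξ 0 + ξ 1 ≤ b 0 + b 1)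
    (h₃ : ξ 0 + ξ 1 + ξ 2 ≤ b 0 + b 1 + b 2) : b ∈ S := by
  have hv : ∀ u : Fin 3 → ℝ, u = ![u 0, u 1, u 2] := fun u => by
    ext i; fin_cases i <;> rfl
  have hlast : ∀ x p q : ℝ, ![x, p, q] ∈ S → ![x, q, p] ∈ S := fun x p q h => by
    convert hperm (Equiv.swap 1 2) _ h using 1
    ext i; fin_cases i <;> rfl
  have hfirst : ∀ x p q : ℝ, ![x, p, q] ∈ S → ![p, x, q] ∈ S := fun x p q h => by
    convert hperm (Equiv.swap 0 1) _ h using 1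
    ext i; fin_cases i <;> rfl
  have hξ01 : ξ 0 ≤ ξ 1 := hξm (by decide)
  have hξ12 : ξ 1 ≤ ξ 2 := hξm (by decide)
  have hb01 : b 0 ≤ b 1 := hbm (by decide)
  have hb12 : b 1 ≤ b 2 := hbm (by decide)
  have hξS : ![ξ 0, ξ 1, ξ 2] ∈ S := hv ξ ▸ hξ
  rw [hv b]
  rcases le_total (b 0) (ξ 1) with h | h
  · have e1 : ![ξ 2, ξ 0, ξ 1] ∈ S := hfirst _ _ _ (hlast _ _ _ hξS)
    have e2 : ![ξ 2, b 0, ξ 0 + ξ 1 - b 0] ∈ S :=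
      mem_of_pair_le hconv hup hlast e1 hξ01 h₁ (by linarith) (by linarith)
    have e3 : ![b 0, ξ 0 + ξ 1 - b 0, ξ 2] ∈ S := hlast _ _ _ (hfirst _ _ _ e2)
    exact mem_of_pair_le hconv hup hlast e3 (by linarith) (by linarith) (by linarith) (by linarith)
  · rcases le_total (b 0) (ξ 2) with h' | h'
    · have e2 : ![ξ 0, b 0, ξ 1 + ξ 2 - b 0] ∈ S :=
        mem_of_pair_le hconv hup hlast hξS hξ12 h (by linarith) (by linarith)
      exact mem_of_pair_le hconv hup hlast (hfirst _ _ _ e2) (by linarith) (by linarith)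
        (by linarith) (by linarith)
    · refine hup (fun i => ?_) hξS
      fin_cases i <;> simp <;> linarith

section xi

variable {a₁ a₂ : ℝ}

theorem xi_monotone : Monotone (xi a₁ a₂) := Tuple.monotone_sort _

theorem xi_pos (ha₁ : 0 < a₁) (ha₂ : 0 < a₂) (i : Fin 3) : 0 < xi a₁ a₂ i := by
  have h : ∀ j, 0 < basePoint a₁ a₂ j := fun j => by
    fin_cases j <;> simp [basePoint] <;> positivity
  exact h _

theorem xi_comp_mem_vertexSet (σ : Equiv.Perm (Fin 3)) : xi a₁ a₂ ∘ σ ∈ vertexSet a₁ a₂ :=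
  ⟨σ.trans (Tuple.sort (basePoint a₁ a₂)), rfl⟩

theorem exists_perm_of_mem_vertexSet {v : Fin 3 → ℝ} (hv : v ∈ vertexSet a₁ a₂) :
    ∃ σ : Equiv.Perm (Fin 3), v = xi a₁ a₂ ∘ σ := by
  obtain ⟨σ, rfl⟩ := hv
  refine ⟨σ.trans (Tuple.sort (basePoint a₁ a₂)).symm, ?_⟩
  ext i
  simp [xi]

theorem prod_xi (f : ℝ → ℝ) :
    f (xi a₁ a₂ 0) * f (xi a₁ a₂ 1) * f (xi a₁ a₂ 2) = f a₂ * f (a₁ + 1 / 2) * f (2 * a₁) := by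
  have h := Equiv.prod_comp (Tuple.sort (basePoint a₁ a₂)) fun i => f (basePoint a₁ a₂ i)
  simpa only [Fin.prod_univ_three, basePoint, xi, Function.comp, Matrix.cons_val] using h

theorem sum_xi : xi a₁ a₂ 0 + xi a₁ a₂ 1 + xi a₁ a₂ 2 = 3 * a₁ + a₂ + 1 / 2 := by
  have h := Equiv.sum_comp (Tuple.sort (basePoint a₁ a₂)) (basePoint a₁ a₂)
  simp only [Fin.sum_univ_three, basePoint, Matrix.cons_val] at h
  simp only [xi, Function.comp, basePoint]
  linarith

end xi

theorem add_le_add_of_ne {x : Fin 3 → ℝ} (hx : Monotone x) {i j : Fin 3} (hij : i ≠ j) :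
    x 0 + x 1 ≤ x i + x j := by
  have h01 : x 0 ≤ x 1 := hx (by decide)
  have h12 : x 1 ≤ x 2 := hx (by decide)
  fin_cases i <;> fin_cases j <;> simp at hij ⊢ <;> linarith

theorem convex_partial_sum_le (p q r : ℝ) :
    Convex ℝ {b : Fin 3 → ℝ | (p ≤ b 0 ∧ p ≤ b 1 ∧ p ≤ b 2) ∧
      (q ≤ b 0 + b 1 ∧ q ≤ b 1 + b 2 ∧ q ≤ b 0 + b 2) ∧ r ≤ b 0 + b 1 + b 2} := by
  have key : ∀ {α β s u v : ℝ}, 0 ≤ α → 0 ≤ β → α + β = 1 → s ≤ u → s ≤ v → s ≤ α * u + β * v := by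
    intro α β s u v hα hβ h hu hv
    calc s = α * s + β * s := by rw [← add_mul, h, one_mul]
      _ ≤ _ := by gcongr
  rintro u ⟨⟨u0, u1, u2⟩, ⟨u3, u4, u5⟩, u6⟩ v ⟨⟨v0, v1, v2⟩, ⟨v3, v4, v5⟩, v6⟩ α β hα hβ h
  simp only [Set.mem_ofPred_eq, Pi.add_apply, Pi.smul_apply, smul_eq_mul]
  refine ⟨⟨key hα hβ h u0 v0, key hα hβ h u1 v1, key hα hβ h u2 v2⟩,
    ⟨?_, ?_, ?_⟩, ?_⟩
  · linarith [key hα hβ h u3 v3]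
  · linarith [key hα hβ h u4 v4]
  · linarith [key hα hβ h u5 v5]
  · linarith [key hα hβ h u6 v6]

/-- The inequalities cut out a convex set containing every octant, hence the hull. Conversely, both
sides are permutation invariant, so `b` can be sorted and `mem_of_sorted` applied. -/
theorem mem_newtonPolyhedron_vertexSet_iff (a₁ a₂ : ℝ) (b : Fin 3 → ℝ) :
    b ∈ newtonPolyhedron (vertexSet a₁ a₂) ↔
      (xi a₁ a₂ 0 ≤ b 0 ∧ xi a₁ a₂ 0 ≤ b 1 ∧ xi a₁ a₂ 0 ≤ b 2) ∧
      (xi a₁ a₂ 0 + xi a₁ a₂ 1 ≤ b 0 + b 1 ∧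
        xi a₁ a₂ 0 + xi a₁ a₂ 1 ≤ b 1 + b 2 ∧
        xi a₁ a₂ 0 + xi a₁ a₂ 1 ≤ b 0 + b 2) ∧
      3 * a₁ + a₂ + 1 / 2 ≤ b 0 + b 1 + b 2 := by
  rw [← sum_xi]
  constructor
  · intro hb
    refine convexHull_min (fun u hu => ?_) (convex_partial_sum_le (xi a₁ a₂ 0)
      (xi a₁ a₂ 0 + xi a₁ a₂ 1) (xi a₁ a₂ 0 + xi a₁ a₂ 1 + xi a₁ a₂ 2)) hb
    simp only [Set.mem_iUnion, Set.mem_Ici] at hu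
    obtain ⟨x, hx, hxu⟩ := hu
    obtain ⟨σ, rfl⟩ := exists_perm_of_mem_vertexSet hx
    have h0 := hxu 0
    have h1 := hxu 1
    have h2 := hxu 2
    simp only [Function.comp] at h0 h1 h2
    have hm := xi_monotone (a₁ := a₁) (a₂ := a₂)
    have hle : ∀ i, xi a₁ a₂ 0 ≤ xi a₁ a₂ i := fun i => hm (Fin.zero_le i)
    have hpair : ∀ i j : Fin 3, i ≠ j →
        xi a₁ a₂ 0 + xi a₁ a₂ 1 ≤ xi a₁ a₂ (σ i) + xi a₁ a₂ (σ j) :=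
      fun i j hij => add_le_add_of_ne hm (σ.injective.ne hij)
    have hsum := Equiv.sum_comp σ (xi a₁ a₂)
    simp only [Fin.sum_univ_three] at hsum
    exact ⟨⟨(hle _).trans h0, (hle _).trans h1, (hle _).trans h2⟩,
      ⟨(hpair 0 1 (by decide)).trans (add_le_add h0 h1),
        (hpair 1 2 (by decide)).trans (add_le_add h1 h2),
        (hpair 0 2 (by decide)).trans (add_le_add h0 h2)⟩, by linarith⟩
  · rintro ⟨hmin, hpair, hsum⟩
    have hperm : ∀ σ : Equiv.Perm (Fin 3), ∀ b ∈ newtonPolyhedron (vertexSet a₁ a₂),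
        b ∘ σ ∈ newtonPolyhedron (vertexSet a₁ a₂) := by
      refine fun σ b hb => comp_perm_mem_newtonPolyhedron σ (fun x hx => ?_) hb
      obtain ⟨τ, rfl⟩ := hx
      exact ⟨σ.trans τ, rfl⟩
    have hξ : xi a₁ a₂ ∈ newtonPolyhedron (vertexSet a₁ a₂) :=
      subset_convexHull ℝ _ (Set.mem_biUnion (xi_comp_mem_vertexSet 1) Set.self_mem_Ici)
    have hle : ∀ i, xi a₁ a₂ 0 ≤ b i := fun i => by
      fin_cases i <;> simp [hmin]
    have hle' : ∀ i j : Fin 3, i ≠ j → xi a₁ a₂ 0 + xi a₁ a₂ 1 ≤ b i + b j := fun i j hij => by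
      fin_cases i <;> fin_cases j <;> simp at hij ⊢ <;> linarith
    have hs := Equiv.sum_comp (Tuple.sort b) b
    simp only [Fin.sum_univ_three] at hs
    have hsorted : b ∘ Tuple.sort b ∈ newtonPolyhedron (vertexSet a₁ a₂) :=
      mem_of_sorted (convex_convexHull ℝ _) (isUpperSet_newtonPolyhedron _) hperm hξ xi_monotone
        (Tuple.monotone_sort b) (hle _) (hle' _ _ ((Tuple.sort b).injective.ne (by decide)))
        (by simp only [Function.comp]; linarith)
    convert hperm (Tuple.sort b).symm _ hsorted using 1
    ext i
    simp

/-! ### Transfer from the base point to the polyhedron -/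

open Finset in
-- Evaluating the base terms at `-1` puts the alternating sign into the coefficients, leaving a
-- power series in `t ≥ 0`.
theorem twoFThreeTerm_eq_div_prod {a₁ a₂ : ℝ} (ha₁ : 0 < a₁) (ha₂ : 0 < a₂) {b : Fin 3 → ℝ}
    (hb : ∀ i, 0 < b i) {P : ℕ → ℝ}
    (hP : ∀ j : ℕ, P j = (b 0 + j) * (b 1 + j) * (b 2 + j) /
      ((xi a₁ a₂ 0 + j) * (xi a₁ a₂ 1 + j) * (xi a₁ a₂ 2 + j))) (t : ℝ) (n : ℕ) :
    twoFThreeTerm a₁ a₂ b (-t) n =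
      twoFThreeTerm a₁ a₂ (basePoint a₁ a₂) (-1) n / (∏ j ∈ range n, P j) * t ^ n := by
  have hprod : ∏ j ∈ range n, P j =
      ((ascPochhammer ℝ n).eval (b 0) * (ascPochhammer ℝ n).eval (b 1) *
        (ascPochhammer ℝ n).eval (b 2)) /
      ((ascPochhammer ℝ n).eval a₂ * (ascPochhammer ℝ n).eval (a₁ + 1 / 2) *
        (ascPochhammer ℝ n).eval (2 * a₁)) := by
    rw [← prod_xi fun c => (ascPochhammer ℝ n).eval c]
    simp only [ascPochhammer_eval_eq_prod_range, ← prod_mul_distrib, ← prod_div_distrib, hP]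
  have h0 := (ascPochhammer_pos n _ (hb 0)).ne'
  have h1 := (ascPochhammer_pos n _ (hb 1)).ne'
  have h2 := (ascPochhammer_pos n _ (hb 2)).ne'
  have k0 := (ascPochhammer_pos n _ ha₂).ne'
  have k1 := (ascPochhammer_pos n (a₁ + 1 / 2) (by positivity)).ne'
  have k2 := (ascPochhammer_pos n (2 * a₁) (by positivity)).ne'
  have hn : (n.factorial : ℝ) ≠ 0 := by positivity
  rw [hprod]
  simp only [twoFThreeTerm, basePoint, Matrix.cons_val, neg_pow t]
  generalize (ascPochhammer ℝ n).eval (a₁ + 1 / 2) = u at *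
  field_simp

/-- The coefficients of `₂F₃` at the base point, as a series in `-z`. -/
theorem nonnegSeries_basePoint {a₁ a₂ : ℝ} (ha₁ : 0 < a₁) (ha₂ : 0 < a₂) :
    NonnegSeries (twoFThreeTerm a₁ a₂ (basePoint a₁ a₂) (-1)) := by
  have hterm : ∀ t : ℝ, (fun n => twoFThreeTerm a₁ a₂ (basePoint a₁ a₂) (-1) n * t ^ n) =
      twoFThreeTerm a₁ a₂ (basePoint a₁ a₂) (-t) := fun t => by
    ext n
    rw [twoFThreeTerm, twoFThreeTerm, neg_pow t]
    ring
  refine ⟨fun t => ?_, fun t _ => ?_⟩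
  · rw [hterm]
    refine summable_twoFThreeTerm ha₁ ha₂ (fun j => ?_) _
    fin_cases j <;> simp [basePoint] <;> positivity
  · rw [hterm, ← twoFThree, twoFThree_basePoint ha₁ ha₂]
    positivity

theorem twoFThree_nonneg_and_pos {a₁ a₂ : ℝ} (ha₁ : 0 < a₁) (ha₂ : 0 < a₂) {b : Fin 3 → ℝ}
    (hb : b ∈ newtonPolyhedron (vertexSet a₁ a₂)) {t : ℝ} (ht : 0 ≤ t) :
    0 ≤ twoFThree a₁ a₂ b (-t) ∧ (b ∉ vertexSet a₁ a₂ → 0 < twoFThree a₁ a₂ b (-t)) := by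
  obtain ⟨⟨h0, h1, h2⟩, ⟨h01, h12, h02⟩, hs⟩ := (mem_newtonPolyhedron_vertexSet_iff a₁ a₂ b).1 hb
  rw [← sum_xi] at hs
  have hx := xi_pos ha₁ ha₂
  have hbpos : ∀ i, 0 < b i := fun i => by
    refine (hx 0).trans_le ?_
    fin_cases i <;> assumption
  have hx01 : xi a₁ a₂ 0 ≤ xi a₁ a₂ 1 := xi_monotone (by decide)
  have hB := newton_coeff_nonneg h0 h1 h2 h01 h12 h02 hx01
  set x := xi a₁ a₂ 0
  set y := xi a₁ a₂ 1
  set z := xi a₁ a₂ 2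
  set A := b 0 + b 1 + b 2 - (x + y + z) with hAdef
  set B := (b 0 - x) * (b 1 - x) + (b 1 - x) * (b 2 - x) + (b 0 - x) * (b 2 - x) -
    (y - x) * (b 0 - x + (b 1 - x) + (b 2 - x)) + (y - x) ^ 2 with hBdef
  set C := (b 0 - x) * (b 1 - x) * (b 2 - x) with hCdef
  have hA : 0 ≤ A := sub_nonneg.2 hs
  have hC : 0 ≤ C := mul_nonneg (mul_nonneg (sub_nonneg.2 h0) (sub_nonneg.2 h1)) (sub_nonneg.2 h2)
  -- Newton interpolation of the numerator: `C` is its value at `-x`, `B` its divided difference at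
  -- `-x, -y` (in polynomial form, so `x = y` is allowed), and `A` compares the quadratic
  -- coefficients.
  have hP : ∀ j : ℕ, newtonRatio A B C x y z j = (b 0 + j) * (b 1 + j) * (b 2 + j) /
      ((x + j) * (y + j) * (z + j)) := by
    intro j
    have k0 : (j : ℝ) + x ≠ 0 := by have := hx 0; positivity
    have k1 : (j : ℝ) + y ≠ 0 := by have := hx 1; positivity
    have k2 : (j : ℝ) + z ≠ 0 := by have := hx 2; positivity
    rw [add_comm x, add_comm y, add_comm z, newtonRatio]
    field_simp
    rw [hAdef, hBdef, hCdef]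
    ring
  have hc := nonnegSeries_basePoint ha₁ ha₂
  have hsum : twoFThree a₁ a₂ b (-t) = _ :=
    tsum_congr (twoFThreeTerm_eq_div_prod ha₁ ha₂ hbpos hP t)
  rw [hsum]
  refine ⟨(hc.div_prod_newtonRatio hA hB hC (hx 0) (hx 1) (hx 2)).nonneg t ht, fun hbv => ?_⟩
  refine hc.div_prod_newtonRatio_pos (by simp [twoFThreeTerm]) hA hB hC ?_ (hx 0) (hx 1) (hx 2) ht
  -- Nonnegative numbers without a positive sum all vanish, which would make `b` a vertex.
  by_contra hle
  obtain ⟨σ, hσ⟩ := exists_perm_of_newton_coeff_eq_zero (b := b) (ξ := xi a₁ a₂)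
    (show C = 0 by linarith) (show B = 0 by linarith) (show A = 0 by linarith)
  exact hbv (hσ ▸ xi_comp_mem_vertexSet σ)

theorem theorem2 (a₁ a₂ : ℝ) (ha₁ : 0 < a₁) (ha₂ : 0 < a₂) :
    ((a₁, a₂) ∈ admissible →
      ∀ b ∈ newtonPolyhedron (vertexSet a₁ a₂),
        (∀ x : ℝ, 0 < x → 0 ≤ twoFThree a₁ a₂ b (-x ^ 2)) ∧
        (b ∉ vertexSet a₁ a₂ → ∀ x : ℝ, 0 < x → 0 < twoFThree a₁ a₂ b (-x ^ 2))) ∧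
    (∀ b : Fin 3 → ℝ, b ∈ newtonPolyhedron (vertexSet a₁ a₂) ↔
      (xi a₁ a₂ 0 ≤ b 0 ∧ xi a₁ a₂ 0 ≤ b 1 ∧ xi a₁ a₂ 0 ≤ b 2) ∧
      (xi a₁ a₂ 0 + xi a₁ a₂ 1 ≤ b 0 + b 1 ∧
        xi a₁ a₂ 0 + xi a₁ a₂ 1 ≤ b 1 + b 2 ∧
        xi a₁ a₂ 0 + xi a₁ a₂ 1 ≤ b 0 + b 2) ∧
      3 * a₁ + a₂ + 1 / 2 ≤ b 0 + b 1 + b 2) :=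
  ⟨fun _ _ hb => ⟨fun x _ => (twoFThree_nonneg_and_pos ha₁ ha₂ hb (sq_nonneg x)).1,
    fun hbv x _ => (twoFThree_nonneg_and_pos ha₁ ha₂ hb (sq_nonneg x)).2 hbv⟩,
    mem_newtonPolyhedron_vertexSet_iff a₁ a₂⟩
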